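/- Let $n\ge 2$ be an integer. Let $Gr_n$ be the graph with vertex set $V(Gr_n)=\{0,\dots,2^n\}^2$ and directed edge set $E(Gr_n)=\{(u,v)\in V(Gr_n)^2 : v=u+(1,0)\text{ or }v=u+(0,1)\}$, equipped with the shortest path metric (unit edge lengths, orientation ignored); $\operatorname{diam}$ and $\operatorname{dist}$ refer to this metric. For $0\le k\le n-2$ let $T_k=\{1,2,3,4\}^k$ (with $\{1,2,3,4\}^0=\{\emptyset\}$), let $T=\bigcup_{k=0}^{n-2}T_k$, and write $|t|=k$ for $t\in T_k$. The support of a signed measure $\mu$ on $V(Gr_n)$ is $\operatorname{supp}(\mu)=\{v:\mu(\{v\})\ne 0\}$. Let $\tfrac12\le C_2,C_4<\infty$ and let $\{\mu_t\}_{t\in T}$ be signed measures on $V(Gr_n)$ of total mass $0$, i.e. $\mu_t(V(Gr_n))=0$, such that for every $t\in T$: (P2) if $t'\in T\setminus\{t\}$, then $\operatorname{dist}(\operatorname{supp}(\mu_t),\operatorname{supp}(\mu_{t'}))\ge C_2^{-1}2^{\,n-\max(|t|,|t'|)}$ (this is void if one of the supports is empty); (P4) for every $A\subseteq V(Gr_n)$,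 $|\mu_t(A)|\le C_4\min\{2^{-n-1-|t|},\,4^{-n}(\operatorname{diam}(A)+1)\}$, with $\operatorname{diam}(\emptyset)=0$; (P5) there is $u\in V(Gr_n)$ such that $\operatorname{supp}(\mu_t)\cup\{u\}$ is connected, that is, induces a connected subgraph of $Gr_n$. Then every function $f:V(Gr_n)\to\mathbb{R}$ satisfies $$\sum_{k=0}^{n-2}\Big(\sum_{t\in T_k}\Big|\int f\,d\mu_t\Big|^2\Big)^{1/2}\le C_4(20+40C_2)\sum_{(u,v)\in E(Gr_n)}|f(u)-f(v)|\,\frac{1}{|E(Gr_n)|}.$$ -/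

import Mathlib

open MeasureTheory
open scoped BigOperators

namespace DyadicGrid

/-- The vertex set `{0, …, 2^n}²`. It carries the discrete (product) σ-algebra, so that every
subset is measurable. -/
abbrev Vertex (n : ℕ) : Type := Fin (2 ^ n + 1) × Fin (2 ^ n + 1)

/-- The directed edges `(u, v)`, where `v = u + (1,0)` or `v = u + (0,1)`. -/
def edges (n : ℕ) : Finset (Vertex n × Vertex n) :=
  Finset.univ.filter fun e =>
    ((e.2.1 : ℕ) = (e.1.1 : ℕ) + 1 ∧ (e.2.2 : ℕ) = (e.1.2 : ℕ)) ∨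
      ((e.2.1 : ℕ) = (e.1.1 : ℕ) ∧ (e.2.2 : ℕ) = (e.1.2 : ℕ) + 1)

/-- The dyadic planar grid, as an undirected graph: two vertices are adjacent when a directed edge
joins them in one of the two directions. -/
def graph (n : ℕ) : SimpleGraph (Vertex n) where
  Adj u v := (u, v) ∈ edges n ∨ (v, u) ∈ edges n
  symm := ⟨fun _ _ h => h.symm⟩
  loopless := ⟨fun u h => by simp [edges] at h⟩

/-- The diameter of a set of vertices with respect to the shortest path metric (`0` for `∅`). -/
noncomputable def diam {n : ℕ} (A : Finset (Vertex n)) : ℕ :=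
  (A ×ˢ A).sup fun p => (graph n).dist p.1 p.2

/-- The `k`-th generation `{1,2,3,4}^k` of the regular rooted tree with branching number `4`. -/
abbrev Generation (k : ℕ) : Type := Fin k → Fin 4

/-- The tree `T = ⋃_{k=0}^{n-2} {1,2,3,4}^k`, as a disjoint union (used for `n ≥ 2`). -/
abbrev Tree (n : ℕ) : Type := Σ k : Fin (n - 1), Generation k

/-- The generation `|t|` of `t`. -/
def gen {n : ℕ} (t : Tree n) : ℕ := t.1

/-- The support `{v | μ {v} ≠ 0}` of a signed measure on the vertex set. -/
def supp {n : ℕ} (μ : SignedMeasure (Vertex n)) : Set (Vertex n) := {v | μ {v} ≠ 0}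

/-- A family of transportation problems: signed measures of total mass `0`. -/
def ZeroMass {n : ℕ} (μ : Tree n → SignedMeasure (Vertex n)) : Prop :=
  ∀ t, μ t Set.univ = 0

/-- The supports are separated: `dist (supp μ_t, supp μ_{t'}) ≥ C₂⁻¹ 2^{n - max(|t|,|t'|)}` for
`t ≠ t'`. The distance of two sets is the infimum of the distances of their points (`∞` if one of
them is empty), so the lower bound is a lower bound for all pairs of points. -/
def Separated {n : ℕ} (μ : Tree n → SignedMeasure (Vertex n)) (C₂ : ℝ) : Prop :=
  ∀ t t' : Tree n, t ≠ t' → ∀ x ∈ supp (μ t), ∀ y ∈ supp (μ t'),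
    C₂⁻¹ * (2 : ℝ) ^ ((n : ℤ) - (max (gen t) (gen t') : ℕ)) ≤ ((graph n).dist x y : ℝ)

/-- For every set `A` of vertices,
`|μ_t(A)| ≤ C₄ min {2^{-n-1-|t|}, 4^{-n} (diam A + 1)}`. -/
def SizeBound {n : ℕ} (μ : Tree n → SignedMeasure (Vertex n)) (C₄ : ℝ) : Prop :=
  ∀ (t : Tree n) (A : Finset (Vertex n)),
    |μ t (A : Set (Vertex n))| ≤
      C₄ * min ((2 : ℝ) ^ (-(n : ℤ) - 1 - (gen t : ℤ)))
        ((4 : ℝ) ^ (-(n : ℤ)) * ((diam A : ℝ) + 1))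

/-- Each support becomes a connected set of vertices (that is, one which induces a connected
subgraph) after adding a suitable vertex. -/
def AlmostConnected {n : ℕ} (μ : Tree n → SignedMeasure (Vertex n)) : Prop :=
  ∀ t : Tree n, ∃ u : Vertex n, ((graph n).induce (supp (μ t) ∪ {u})).Connected

/-- The uniform probability measure on the set of directed edges. -/
noncomputable def thickness (n : ℕ) (_e : Vertex n × Vertex n) : ℝ := 1 / ((edges n).card : ℝ)

end DyadicGrid

/-! The left side is a seminorm of `f` vanishing on constants, so it is enough to test it on the
elementary pieces of total variation. The layer-cake formula (`le_totalVar_of_forall_ind`) reduces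
to indicators. A discrete Poincaré lemma (`exists_restrict_cut`) then separates distant parts of a
boundary, so that `le_totalVar_of_forall_chained` leaves only sets `A` whose boundary `F` is
coarsely connected.

Let `F` have `P` edges and put `r k = 2^(n-k) / C₂`. Only measures whose support touches `F` charge
`A` (`meets_of_apply_ne_zero`). Since `F` has diameter less than `2P`, two touching measures, the
deeper one in generation `k`, force `r k ≤ 2P`. If `N ≥ 2` measures of generation `k` touch `F`,
packing balls along `F` gives `N * r k ≤ 6P` (`card_filter_meets_mul_le`). With the mass bound, such
a generation contributes at most a constant times `C₂ C₄ 4^(-n) √P √(r k)`, and this sums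
geometrically to order `4^(-n) P`.

The one possible exception is a single touching measure in the shallowest touching generation. There
the diameter bound is used: `A` or its complement has diameter at most `4P`
(`diam_le_or_diam_compl_le`), which again gives order `4^(-n) P`. -/

namespace DyadicGrid

variable {n : ℕ}

/-! ### Signed measures on the vertex set -/

theorem signedMeasure_apply_finset {X : Type*} [MeasurableSpace X] [MeasurableSingletonClass X]
    (μ : SignedMeasure X) (A : Finset X) : μ (A : Set X) = ∑ v ∈ A, μ {v} := by
  classical
  induction A using Finset.induction_on with
  | empty => simp
  | insert a s ha ih =>
    rw [Finset.sum_insert ha, ← ih, Finset.coe_insert, Set.insert_eq,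
      VectorMeasure.of_union (by simpa using ha) (measurableSet_singleton a)
        s.measurableSet]

theorem integral_signedMeasure_eq_sum {X : Type*} [Fintype X] [MeasurableSpace X]
    [MeasurableSingletonClass X] (μ : SignedMeasure X) (f : X → ℝ) :
    ∫ᵛ v, f v ∂•μ = ∑ v, f v * μ {v} := by
  classical
  have hf : f = fun x => ∑ v, f v • Set.indicator {v} (fun _ => (1 : ℝ)) x := by
    funext x
    simp [Set.indicator_apply]
  conv_lhs => rw [hf]
  rw [VectorMeasure.integral_finsetSum _ fun i _ => Integrable.of_finite]
  refine Finset.sum_congr rfl fun v _ => ?_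
  rw [VectorMeasure.integral_fun_smul, VectorMeasure.integral_eq_setToFun,
    setToFun_indicator_const _ (measurableSet_singleton v) (measure_ne_top _ _)]
  simp [transpose_eq_cbmApplyMeasure]

/-! ### The mixed norm of the family of integrals -/

/-- The `ℓ¹(ℓ²)` norm of the integrals of `f`, the inner norm running over a generation. -/
noncomputable def mixedNorm (μ : Tree n → SignedMeasure (Vertex n)) (f : Vertex n → ℝ) : ℝ :=
  ∑ k : Fin (n - 1), Real.sqrt (∑ t : Generation k, |∑ v, f v * μ ⟨k, t⟩ {v}| ^ 2)

theorem mixedNorm_eq_sum_norm (μ : Tree n → SignedMeasure (Vertex n)) (f : Vertex n → ℝ) :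
    mixedNorm μ f = ∑ k : Fin (n - 1),
      ‖WithLp.toLp 2 fun t : Generation k => ∑ v, f v * μ ⟨k, t⟩ {v}‖ := by
  simp [mixedNorm, EuclideanSpace.norm_eq]

theorem mixedNorm_add_le (μ : Tree n → SignedMeasure (Vertex n)) (f g : Vertex n → ℝ) :
    mixedNorm μ (f + g) ≤ mixedNorm μ f + mixedNorm μ g := by
  simp only [mixedNorm_eq_sum_norm]
  rw [← Finset.sum_add_distrib]
  refine Finset.sum_le_sum fun k _ => ?_
  refine le_trans (le_of_eq ?_) (norm_add_le _ _)
  rw [← WithLp.toLp_add]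
  congr 2
  funext t
  simp [add_mul, Finset.sum_add_distrib]

theorem mixedNorm_smul_le (μ : Tree n → SignedMeasure (Vertex n)) {c : ℝ} (hc : 0 ≤ c)
    (f : Vertex n → ℝ) : mixedNorm μ (c • f) ≤ c * mixedNorm μ f := by
  simp only [mixedNorm_eq_sum_norm]
  rw [Finset.mul_sum]
  refine Finset.sum_le_sum fun k _ => ?_
  refine le_of_eq ?_
  rw [← abs_of_nonneg hc, ← Real.norm_eq_abs, ← norm_smul, ← WithLp.toLp_smul]
  congr 2
  funext t
  simp [Finset.mul_sum, mul_assoc, abs_of_nonneg hc]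

theorem mixedNorm_const {μ : Tree n → SignedMeasure (Vertex n)} (hzero : ZeroMass μ) (c : ℝ) :
    mixedNorm μ (fun _ => c) = 0 := by
  refine Finset.sum_eq_zero fun k _ => ?_
  have h (t : Generation k) : ∑ v, μ ⟨k, t⟩ {v} = 0 := by
    rw [← signedMeasure_apply_finset, Finset.coe_univ, hzero]
  simp [← Finset.mul_sum, h]

/-! ### Cut edges and total variation -/

/-- The edges on which `f` is not constant. -/
noncomputable def cut (f : Vertex n → ℝ) : Finset (Vertex n × Vertex n) :=
  (edges n).filter fun e => f e.1 ≠ f e.2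

/-- The total variation of `f` along the edges. -/
noncomputable def totalVar (f : Vertex n → ℝ) : ℝ := ∑ e ∈ edges n, |f e.1 - f e.2|

/-- The real indicator function of a finite set of vertices. -/
noncomputable def ind (A : Finset (Vertex n)) : Vertex n → ℝ :=
  fun v => if v ∈ A then 1 else 0

theorem mem_cut {f : Vertex n → ℝ} {e : Vertex n × Vertex n} :
    e ∈ cut f ↔ e ∈ edges n ∧ f e.1 ≠ f e.2 := Finset.mem_filter

theorem totalVar_ind (A : Finset (Vertex n)) : totalVar (ind A) = ((cut (ind A)).card : ℝ) := by
  rw [cut, Finset.card_filter, totalVar]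
  push_cast
  refine Finset.sum_congr rfl fun e _ => ?_
  by_cases h1 : e.1 ∈ A <;> by_cases h2 : e.2 ∈ A <;> simp [ind, h1, h2]

theorem totalVar_nonneg (f : Vertex n → ℝ) : 0 ≤ totalVar f :=
  Finset.sum_nonneg fun _ _ => abs_nonneg _

/-- Layer-cake decomposition: a sublinear functional which vanishes on constants is bounded by the
total variation of `f` as soon as this holds for the indicators whose cut edges are cut by `f`. -/
theorem le_totalVar_of_forall_ind {L : (Vertex n → ℝ) → ℝ} {C : ℝ}
    (hadd : ∀ f g, L (f + g) ≤ L f + L g) (hsmul : ∀ c : ℝ, 0 ≤ c → ∀ f, L (c • f) ≤ c * L f)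
    (hconst : ∀ c : ℝ, L (fun _ => c) ≤ 0) (hC : 0 ≤ C) (f : Vertex n → ℝ)
    (h : ∀ A, cut (ind A) ⊆ cut f → L (ind A) ≤ C * totalVar (ind A)) :
    L f ≤ C * totalVar f := by
  induction hN : (Finset.univ.image f).card using Nat.strong_induction_on generalizing f with
  | _ N ih =>
  subst hN
  have hne : (Finset.univ.image f).Nonempty := Finset.univ_nonempty.image f
  set m := (Finset.univ.image f).min' hne with hm
  have hle (v) : m ≤ f v := Finset.min'_le _ _ (by simp)
  have hmem : m ∈ Finset.univ.image f := Finset.min'_mem _ hne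
  by_cases hne' : ((Finset.univ.image f).erase m).Nonempty
  swap
  · have hfm : f = fun _ => m := by
      funext v
      by_contra hv
      exact hne' ⟨f v, by simp [hv]⟩
    have h0 := mul_nonneg hC (totalVar_nonneg f)
    rw [hfm] at h0 ⊢
    exact (hconst m).trans h0
  set m' := ((Finset.univ.image f).erase m).min' hne' with hm'
  have hle' (v) (hv : f v ≠ m) : m' ≤ f v := Finset.min'_le _ _ (by simp [hv])
  have hmem' : m' ∈ (Finset.univ.image f).erase m := Finset.min'_mem _ hne'
  have hlt : m < m' := by
    rw [Finset.mem_erase] at hmem'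
    refine lt_of_le_of_ne (Finset.min'_le _ _ hmem'.2) hmem'.1.symm
  -- Peeling off the lowest layer: `g` merges the two smallest values `m < m'` of `f`, so it takes
  -- fewer values.
  set A : Finset (Vertex n) := Finset.univ.filter fun v => f v ≠ m with hA
  set g : Vertex n → ℝ := f - (m' - m) • ind A with hg
  have hgv (v) : g v = if f v = m then m else f v - (m' - m) := by
    by_cases hv : f v = m <;> simp [hg, ind, hA, hv]
  have hcutA : cut (ind A) ⊆ cut f := by
    intro e
    simp only [mem_cut, and_imp]
    refine fun he h => ⟨he, fun h' => h ?_⟩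
    simp [ind, hA, h']
  have hcutg : cut g ⊆ cut f := by
    intro e
    simp only [mem_cut, and_imp]
    refine fun he h => ⟨he, fun h' => h ?_⟩
    simp [hgv, h']
  -- No value lies strictly between `m` and `m'`, so along each edge `g` and `ind A` vary in the
  -- same direction and the variations add.
  have hvar : totalVar f = totalVar g + (m' - m) * totalVar (ind A) := by
    simp only [totalVar]
    rw [Finset.mul_sum, ← Finset.sum_add_distrib]
    refine Finset.sum_congr rfl fun e _ => ?_
    by_cases h1 : f e.1 = m <;> by_cases h2 : f e.2 = m
    · simp [hgv, ind, hA, h1, h2]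
    · have := hle' _ h2
      simp only [hgv, ind, hA, h1, h2, Finset.mem_filter, Finset.mem_univ, true_and, ne_eq,
        not_true, not_false_eq_true, if_true, if_false]
      rw [abs_of_nonpos (by linarith), abs_of_nonpos (by linarith), abs_of_nonpos (by norm_num)]
      ring
    · have := hle' _ h1
      simp only [hgv, ind, hA, h1, h2, Finset.mem_filter, Finset.mem_univ, true_and, ne_eq,
        not_true, not_false_eq_true, if_true, if_false]
      rw [abs_of_nonneg (by linarith), abs_of_nonneg (by linarith), abs_of_nonneg (by norm_num)]
      ring
    · simp [hgv, ind, hA, h1, h2]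
  have hcard : (Finset.univ.image g).card < (Finset.univ.image f).card := by
    refine lt_of_le_of_lt ?_ (Finset.card_erase_lt_of_mem hmem)
    refine le_trans (Finset.card_le_card ?_)
      (Finset.card_image_le (f := fun x => x - (m' - m)))
    intro x
    simp only [Finset.mem_image, Finset.mem_univ, true_and]
    rintro ⟨v, rfl⟩
    rw [hgv]
    split_ifs with hv
    · exact ⟨m', hmem', by ring⟩
    · exact ⟨f v, by simp [hv], rfl⟩
  have hfg : f = g + (m' - m) • ind A := by rw [hg]; abel
  calc L f ≤ L g + L ((m' - m) • ind A) := by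
        conv_lhs => rw [hfg]
        exact hadd _ _
    _ ≤ C * totalVar g + (m' - m) * (C * totalVar (ind A)) := by
        refine add_le_add (ih _ hcard g (fun A hA => h A (hA.trans hcutg)) rfl) ?_
        refine (hsmul _ (by linarith) _).trans ?_
        exact mul_le_mul_of_nonneg_left (h A hcutA) (by linarith)
    _ = C * totalVar f := by rw [hvar]; ring

/-! ### Coordinates -/

/-- The vertex with coordinates `i` and `j`, meaningful for `i, j ≤ 2 ^ n`. -/
def pt (n i j : ℕ) : Vertex n := (Fin.ofNat _ i, Fin.ofNat _ j)

theorem pt_val (v : Vertex n) : pt n v.1 v.2 = v := by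
  simp [pt]

theorem pt_fst {i : ℕ} (hi : i ≤ 2 ^ n) (j : ℕ) : ((pt n i j).1 : ℕ) = i := by
  simp [pt, Nat.mod_eq_of_lt (Nat.lt_succ_of_le hi)]

theorem pt_snd (i : ℕ) {j : ℕ} (hj : j ≤ 2 ^ n) : ((pt n i j).2 : ℕ) = j := by
  simp [pt, Nat.mod_eq_of_lt (Nat.lt_succ_of_le hj)]

theorem mem_edges {e : Vertex n × Vertex n} : e ∈ edges n ↔
    ((e.2.1 : ℕ) = (e.1.1 : ℕ) + 1 ∧ (e.2.2 : ℕ) = (e.1.2 : ℕ)) ∨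
      ((e.2.1 : ℕ) = (e.1.1 : ℕ) ∧ (e.2.2 : ℕ) = (e.1.2 : ℕ) + 1) := by
  simp [edges]

theorem horizontal_mem_edges {i j : ℕ} (hi : i < 2 ^ n) (hj : j ≤ 2 ^ n) :
    (pt n i j, pt n (i + 1) j) ∈ edges n := by
  simp only [mem_edges, pt_fst hi.le, pt_fst (Nat.succ_le_of_lt hi), pt_snd _ hj]
  simp

theorem vertical_mem_edges {i j : ℕ} (hi : i ≤ 2 ^ n) (hj : j < 2 ^ n) :
    (pt n i j, pt n i (j + 1)) ∈ edges n := by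
  simp only [mem_edges, pt_snd _ hj.le, pt_snd _ (Nat.succ_le_of_lt hj), pt_fst hi]
  simp

theorem exists_pt_of_mem_edges {e : Vertex n × Vertex n} (he : e ∈ edges n) :
    (∃ i j, i < 2 ^ n ∧ j ≤ 2 ^ n ∧ e = (pt n i j, pt n (i + 1) j)) ∨
      ∃ i j, i ≤ 2 ^ n ∧ j < 2 ^ n ∧ e = (pt n i j, pt n i (j + 1)) := by
  obtain ⟨u, v⟩ := e
  have h1 := u.1.isLt
  have h2 := u.2.isLt
  have h3 := v.1.isLt
  have h4 := v.2.isLt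
  rcases mem_edges.1 he with ⟨h, h'⟩ | ⟨h, h'⟩ <;> dsimp only at h h'
  · refine Or.inl ⟨u.1, u.2, by omega, by omega, ?_⟩
    rw [← h, ← h', pt_val, h', pt_val]
  · refine Or.inr ⟨u.1, u.2, by omega, by omega, ?_⟩
    rw [← h, ← h', pt_val, h, pt_val]

/-- The `ℓ¹` distance of two vertices. -/
def gridDist (u v : Vertex n) : ℕ :=
  ((u.1 : ℕ) - v.1) + ((v.1 : ℕ) - u.1) + (((u.2 : ℕ) - v.2) + ((v.2 : ℕ) - u.2))

theorem gridDist_comm (u v : Vertex n) : gridDist u v = gridDist v u := by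
  unfold gridDist; omega

theorem gridDist_triangle (u v w : Vertex n) : gridDist u w ≤ gridDist u v + gridDist v w := by
  unfold gridDist; omega

theorem gridDist_self (u : Vertex n) : gridDist u u = 0 := by
  unfold gridDist; omega

theorem gridDist_of_mem_edges {e : Vertex n × Vertex n} (he : e ∈ edges n) :
    gridDist e.1 e.2 = 1 := by
  rw [mem_edges] at he; unfold gridDist; omega

theorem exists_adj_gridDist_lt {u v : Vertex n} (h : u ≠ v) :
    ∃ w, (graph n).Adj u w ∧ gridDist w v + 1 = gridDist u v := by
  have h1 := u.1.isLt
  have h2 := u.2.isLt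
  have h3 := v.1.isLt
  have h4 := v.2.isLt
  have hne : (u.1 : ℕ) ≠ v.1 ∨ (u.2 : ℕ) ≠ v.2 := by
    by_contra! hc
    exact h (Prod.ext (Fin.ext hc.1) (Fin.ext hc.2))
  simp only [graph, mem_edges, gridDist]
  rcases hne with hne | hne <;> rcases lt_or_gt_of_ne hne with hlt | hlt
  · refine ⟨(⟨u.1 + 1, by omega⟩, u.2), ?_, ?_⟩ <;> dsimp only <;> omega
  · refine ⟨(⟨u.1 - 1, by omega⟩, u.2), ?_, ?_⟩ <;> dsimp only <;> omega
  · refine ⟨(u.1, ⟨u.2 + 1, by omega⟩), ?_, ?_⟩ <;> dsimp only <;> omega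
  · refine ⟨(u.1, ⟨u.2 - 1, by omega⟩), ?_, ?_⟩ <;> dsimp only <;> omega

theorem exists_walk_length_eq_gridDist (u v : Vertex n) :
    ∃ p : (graph n).Walk u v, p.length = gridDist u v := by
  induction hd : gridDist u v generalizing u with
  | zero =>
    by_cases h : u = v
    · subst h
      exact ⟨.nil, rfl⟩
    · obtain ⟨w, -, hw⟩ := exists_adj_gridDist_lt h
      omega
  | succ d ih =>
    have h : u ≠ v := by
      rintro rfl
      rw [gridDist_self] at hd
      omega
    obtain ⟨w, hadj, hw⟩ := exists_adj_gridDist_lt h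
    obtain ⟨p, hp⟩ := ih w (by omega)
    exact ⟨.cons hadj p, by simp [hp]⟩

theorem dist_le_gridDist (u v : Vertex n) : (graph n).dist u v ≤ gridDist u v := by
  obtain ⟨p, hp⟩ := exists_walk_length_eq_gridDist u v
  exact hp ▸ SimpleGraph.dist_le p

theorem diam_le {A : Finset (Vertex n)} {d : ℕ}
    (h : ∀ u ∈ A, ∀ v ∈ A, gridDist u v ≤ d) : diam A ≤ d := by
  refine Finset.sup_le fun p hp => ?_
  rw [Finset.mem_product] at hp
  exact (dist_le_gridDist _ _).trans (h _ hp.1 _ hp.2)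

/-! ### Functions without cut edges -/

/-- A horizontal edge starts in the row it lies in, so initial vertices alone detect whether a row
is cut. -/
theorem eq_of_forall_cut_snd_ne {f : Vertex n → ℝ} {b : Fin (2 ^ n + 1)}
    (h : ∀ e ∈ cut f, e.1.2 ≠ b) (a a' : Fin (2 ^ n + 1)) : f (a, b) = f (a', b) := by
  have hb : (b : ℕ) ≤ 2 ^ n := Nat.le_of_lt_succ b.isLt
  have key (i : ℕ) (hi : i ≤ 2 ^ n) : f (pt n i b) = f (pt n 0 b) := by
    induction i with
    | zero => rfl
    | succ i ih =>
      rw [← ih (by omega)]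
      by_contra hne
      refine h (pt n i b, pt n (i + 1) b)
        (mem_cut.2 ⟨horizontal_mem_edges (by omega) hb, fun h' => hne h'.symm⟩) ?_
      exact Fin.ext (pt_snd _ hb)
  have h1 := key a (Nat.le_of_lt_succ a.isLt)
  have h2 := key a' (Nat.le_of_lt_succ a'.isLt)
  rw [← pt_val (a, b), ← pt_val (a', b)]
  exact h1.trans h2.symm

theorem eq_of_forall_cut_fst_ne {f : Vertex n → ℝ} {a : Fin (2 ^ n + 1)}
    (h : ∀ e ∈ cut f, e.1.1 ≠ a) (b b' : Fin (2 ^ n + 1)) : f (a, b) = f (a, b') := by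
  have ha : (a : ℕ) ≤ 2 ^ n := Nat.le_of_lt_succ a.isLt
  have key (j : ℕ) (hj : j ≤ 2 ^ n) : f (pt n a j) = f (pt n a 0) := by
    induction j with
    | zero => rfl
    | succ j ih =>
      rw [← ih (by omega)]
      by_contra hne
      refine h (pt n a j, pt n a (j + 1))
        (mem_cut.2 ⟨vertical_mem_edges ha (by omega), fun h' => hne h'.symm⟩) ?_
      exact Fin.ext (pt_fst ha _)
  have h1 := key b (Nat.le_of_lt_succ b.isLt)
  have h2 := key b' (Nat.le_of_lt_succ b'.isLt)
  rw [← pt_val (a, b), ← pt_val (a, b')]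
  exact h1.trans h2.symm

/-! ### Splitting a function along its cut edges -/

/-- A discrete Poincaré lemma on a square grid. -/
theorem exists_potential (N : ℕ) (h v : ℕ → ℕ → ℝ)
    (hcl : ∀ i < N, ∀ j < N, h i j + v (i + 1) j = v i j + h i (j + 1)) :
    ∃ g : ℕ → ℕ → ℝ, (∀ i < N, ∀ j ≤ N, g (i + 1) j - g i j = h i j) ∧
      ∀ i j, g i (j + 1) - g i j = v i j := by
  -- Integrate along the bottom row, then up the column.
  refine ⟨fun i j => ∑ a ∈ Finset.range i, h a 0 + ∑ b ∈ Finset.range j, v i b,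
    fun i hi j hj => ?_, fun i j => by simp [Finset.sum_range_succ]⟩
  induction j with
  | zero => simp [Finset.sum_range_succ]
  | succ j ih =>
    have h1 := ih (by omega)
    have h2 := hcl i hi j (by omega)
    simp only [Finset.sum_range_succ] at h1 ⊢
    linarith

/-- If the cut edges of `f` fall into two parts which are not close to each other, then the
differences of `f` along one of the parts are those of a function. -/
theorem exists_restrict_cut {f : Vertex n → ℝ} {S : Finset (Vertex n × Vertex n)}
    (hsep : ∀ e ∈ S, ∀ e' ∈ cut f \ S, 2 < gridDist e.1 e'.1) :
    ∃ g : Vertex n → ℝ, (∀ e ∈ edges n, e ∈ S → g e.2 - g e.1 = f e.2 - f e.1) ∧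
      ∀ e ∈ edges n, e ∉ S → g e.2 - g e.1 = 0 := by
  classical
  set w : Vertex n × Vertex n → ℝ := fun e => if e ∈ S then f e.2 - f e.1 else 0 with hw
  -- Near `S` every cut edge belongs to `S`, so there `w` is the full differential of `f`.
  have hfull {e e' : Vertex n × Vertex n} (he : e ∈ S) (he' : e' ∈ edges n)
      (hd : gridDist e.1 e'.1 ≤ 2) : w e' = f e'.2 - f e'.1 := by
    by_cases hS : e' ∈ S
    · simp [hw, hS]
    · by_cases hc : f e'.1 = f e'.2
      · simp [hw, hS, hc]
      · exact absurd (hsep e he e' (by simp [mem_cut, he', hc, hS])) (by omega)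
  obtain ⟨g, hgh, hgv⟩ := exists_potential (2 ^ n)
    (fun i j => w (pt n i j, pt n (i + 1) j)) (fun i j => w (pt n i j, pt n i (j + 1))) (by
      intro i hi j hj
      have e1 := horizontal_mem_edges hi hj.le
      have e2 := vertical_mem_edges (Nat.succ_le_of_lt hi) hj
      have e3 := vertical_mem_edges hi.le hj
      have e4 := horizontal_mem_edges hi (Nat.succ_le_of_lt hj)
      -- Initial vertices of two edges of one unit square are at distance at most 2. This is why 2
      -- is the threshold: around each square `w` is either the differential of `f` or zero, hence
      -- closed.
      have d {a b c d : ℕ} (ha : a ≤ i + 1 := by omega) (hb : b ≤ j + 1 := by omega)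
          (hc : c ≤ i + 1 := by omega) (hd : d ≤ j + 1 := by omega) (ha' : i ≤ a := by omega)
          (hb' : j ≤ b := by omega) (hc' : i ≤ c := by omega) (hd' : j ≤ d := by omega) :
          gridDist (pt n a b) (pt n c d) ≤ 2 := by
        simp only [gridDist, pt_fst (show a ≤ 2 ^ n by omega), pt_fst (show c ≤ 2 ^ n by omega),
          pt_snd _ (show b ≤ 2 ^ n by omega), pt_snd _ (show d ≤ 2 ^ n by omega)]
        omega
      have all {e : Vertex n × Vertex n} (he : e ∈ S)
          (h1 : gridDist e.1 (pt n i j) ≤ 2) (h2 : gridDist e.1 (pt n (i + 1) j) ≤ 2)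
          (h3 : gridDist e.1 (pt n i (j + 1)) ≤ 2) :
          w (pt n i j, pt n (i + 1) j) + w (pt n (i + 1) j, pt n (i + 1) (j + 1)) =
            w (pt n i j, pt n i (j + 1)) + w (pt n i (j + 1), pt n (i + 1) (j + 1)) := by
        rw [hfull he e1 h1, hfull he e2 h2, hfull he e3 h1, hfull he e4 h3]
        ring
      by_cases s1 : (pt n i j, pt n (i + 1) j) ∈ S
      · exact all s1 d d d
      by_cases s2 : (pt n (i + 1) j, pt n (i + 1) (j + 1)) ∈ S
      · exact all s2 d d d
      by_cases s3 : (pt n i j, pt n i (j + 1)) ∈ S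
      · exact all s3 d d d
      by_cases s4 : (pt n i (j + 1), pt n (i + 1) (j + 1)) ∈ S
      · exact all s4 d d d
      simp [hw, s1, s2, s3, s4])
  have key : ∀ e ∈ edges n, g e.2.1 e.2.2 - g e.1.1 e.1.2 = w e := by
    intro e he
    rcases exists_pt_of_mem_edges he with ⟨i, j, hi, hj, rfl⟩ | ⟨i, j, hi, hj, rfl⟩
    · rw [pt_fst hi.le, pt_fst (Nat.succ_le_of_lt hi), pt_snd _ hj, pt_snd _ hj, hgh i hi j hj]
    · rw [pt_fst hi, pt_fst hi, pt_snd _ hj.le, pt_snd _ (Nat.succ_le_of_lt hj), hgv i j]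
  refine ⟨fun v => g v.1 v.2, fun e he hS => ?_, fun e he hS => ?_⟩
  · simp [key e he, hw, hS]
  · simp [key e he, hw, hS]

/-- A set of edges which cannot be split into two nonempty parts that are not close. -/
def Chained (F : Finset (Vertex n × Vertex n)) : Prop :=
  ∀ S ⊆ F, S.Nonempty → S ≠ F → ∃ e ∈ S, ∃ e' ∈ F \ S, gridDist e.1 e'.1 ≤ 2

/-- To bound a sublinear functional which vanishes on constants by the total variation, it is
enough to consider indicators with a chained set of cut edges. -/
theorem le_totalVar_of_forall_chained {L : (Vertex n → ℝ) → ℝ} {C : ℝ}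
    (hadd : ∀ f g, L (f + g) ≤ L f + L g) (hsmul : ∀ c : ℝ, 0 ≤ c → ∀ f, L (c • f) ≤ c * L f)
    (hconst : ∀ c : ℝ, L (fun _ => c) ≤ 0) (hC : 0 ≤ C)
    (h : ∀ A, Chained (cut (ind A)) → L (ind A) ≤ C * totalVar (ind A)) (f : Vertex n → ℝ) :
    L f ≤ C * totalVar f := by
  classical
  -- The two pieces of `ind A` need not be indicators, so the induction runs over all functions. The
  -- layer-cake lemma keeps `cut (ind A)` inside `cut f`, and splitting makes it strictly smaller.
  induction hN : (cut f).card using Nat.strong_induction_on generalizing f with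
  | _ N ih =>
  subst hN
  refine le_totalVar_of_forall_ind hadd hsmul hconst hC f fun A hA => ?_
  by_cases hch : Chained (cut (ind A))
  · exact h A hch
  unfold Chained at hch
  push Not at hch
  obtain ⟨S, hS, hSne, hSF, hsep⟩ := hch
  obtain ⟨g, hg1, hg2⟩ := exists_restrict_cut hsep
  have hcard := Finset.card_le_card hA
  have hSss : S ⊂ cut (ind A) := Finset.ssubset_iff_subset_ne.2 ⟨hS, hSF⟩
  have hcut1 : cut g ⊆ S := by
    intro e he
    rw [mem_cut] at he
    by_contra heS
    exact he.2 (by linarith [hg2 e he.1 heS])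
  have hcut2 : cut (ind A - g) ⊆ cut (ind A) \ S := by
    intro e he
    rw [mem_cut] at he
    obtain ⟨he1, he2⟩ := he
    have heS : e ∉ S := fun heS => he2 (by
      simp only [Pi.sub_apply]
      linarith [hg1 e he1 heS])
    refine Finset.mem_sdiff.2 ⟨mem_cut.2 ⟨he1, fun h' => he2 ?_⟩, heS⟩
    simp only [Pi.sub_apply]
    linarith [hg2 e he1 heS]
  have hvar : totalVar (ind A) = totalVar g + totalVar (ind A - g) := by
    simp only [totalVar]
    rw [← Finset.sum_add_distrib]
    refine Finset.sum_congr rfl fun e he => ?_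
    simp only [Pi.sub_apply]
    by_cases heS : e ∈ S
    · have h1 := hg1 e he heS
      rw [show ind A e.1 - g e.1 - (ind A e.2 - g e.2) = 0 by linarith,
        show g e.1 - g e.2 = ind A e.1 - ind A e.2 by linarith]
      simp
    · have h1 := hg2 e he heS
      rw [show g e.1 - g e.2 = 0 by linarith,
        show ind A e.1 - g e.1 - (ind A e.2 - g e.2) = ind A e.1 - ind A e.2 by linarith]
      simp
  have i1 := ih _ (((Finset.card_le_card hcut1).trans_lt (Finset.card_lt_card hSss)).trans_le
    hcard) g rfl
  have i2 := ih _ ((Finset.card_le_card hcut2).trans_lt ((Finset.card_lt_card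
    (Finset.sdiff_ssubset hS hSne)).trans_le hcard)) (ind A - g) rfl
  calc L (ind A) = L (g + (ind A - g)) := by congr 1; abel
    _ ≤ L g + L (ind A - g) := hadd _ _
    _ ≤ C * totalVar g + C * totalVar (ind A - g) := add_le_add i1 i2
    _ = C * totalVar (ind A) := by rw [hvar]; ring

/-- A chained set is contained in a ball, or the ball contains many of its edges. -/
theorem Chained.subset_ball_or_lt_card {F : Finset (Vertex n × Vertex n)} (hF : Chained F)
    {e : Vertex n × Vertex n} (he : e ∈ F) (r : ℕ) :
    (∀ e' ∈ F, gridDist e.1 e'.1 ≤ 2 * r) ∨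
      r < (F.filter fun e' => gridDist e.1 e'.1 ≤ 2 * r).card := by
  classical
  induction r with
  | zero =>
    right
    exact Finset.card_pos.2 ⟨e, by simp [he, gridDist_self]⟩
  | succ r ih =>
    rcases ih with ih | ih
    · left
      intro e' he'
      have := ih e' he'
      omega
    · set S := F.filter fun e' => gridDist e.1 e'.1 ≤ 2 * r with hS
      by_cases hSF : S = F
      · left
        intro e' he'
        rw [← hSF, hS, Finset.mem_filter] at he'
        omega
      · right
        -- Chainedness supplies an edge just outside the ball; enlarging the radius by 2 captures
        -- it.
        obtain ⟨x, hx, y, hy, hxy⟩ := hF S (Finset.filter_subset _ _)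
          ⟨e, by simp [hS, he, gridDist_self]⟩ hSF
        refine (Nat.succ_le_of_lt ih).trans_lt (Finset.card_lt_card ?_)
        rw [Finset.ssubset_iff_of_subset (Finset.monotone_filter_right _ fun z _ hz => by omega)]
        rw [hS, Finset.mem_filter] at hx
        rw [Finset.mem_sdiff] at hy
        refine ⟨y, Finset.mem_filter.2 ⟨hy.1, ?_⟩, hy.2⟩
        have := gridDist_triangle e.1 x.1 y.1
        omega

/-- A ball of radius `2 * (F.card - 1)` either contains `F` or already holds `F.card` of its edges.
The spare 2 later pays for passing from initial vertices to endpoints at both ends. -/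
theorem Chained.gridDist_add_two_le {F : Finset (Vertex n × Vertex n)} (hF : Chained F)
    {e e' : Vertex n × Vertex n} (he : e ∈ F) (he' : e' ∈ F) :
    gridDist e.1 e'.1 + 2 ≤ 2 * F.card := by
  have hpos : 0 < F.card := Finset.card_pos.2 ⟨e, he⟩
  have key : ∀ e' ∈ F, gridDist e.1 e'.1 ≤ 2 * (F.card - 1) := by
    rcases hF.subset_ball_or_lt_card he (F.card - 1) with h | h
    · exact h
    · refine Finset.filter_eq_self.1 (Finset.eq_of_subset_of_card_le (Finset.filter_subset _ _) ?_)
      omega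
  have := key e' he'
  omega

/-! ### Sets with a chained boundary -/

theorem mem_cut_ind {A : Finset (Vertex n)} {e : Vertex n × Vertex n} :
    e ∈ cut (ind A) ↔ e ∈ edges n ∧ ¬(e.1 ∈ A ↔ e.2 ∈ A) := by
  rw [mem_cut]
  by_cases h1 : e.1 ∈ A <;> by_cases h2 : e.2 ∈ A <;> simp [ind, h1, h2]

theorem ind_eq_ind_iff {A : Finset (Vertex n)} {u v : Vertex n} :
    ind A u = ind A v ↔ (u ∈ A ↔ v ∈ A) := by
  by_cases h1 : u ∈ A <;> by_cases h2 : v ∈ A <;> simp [ind, h1, h2]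

theorem gridDist_le (u v : Vertex n) : gridDist u v ≤ 2 * 2 ^ n := by
  have h1 := u.1.isLt
  have h2 := u.2.isLt
  have h3 := v.1.isLt
  have h4 := v.2.isLt
  unfold gridDist
  omega

/-- A set with a chained boundary is small, or its complement is. -/
theorem diam_le_or_diam_compl_le {A : Finset (Vertex n)} (hF : Chained (cut (ind A))) :
    diam A ≤ 4 * (cut (ind A)).card ∨ diam Aᶜ ≤ 4 * (cut (ind A)).card := by
  classical
  rcases lt_or_ge (2 ^ n) (cut (ind A)).card with hP | hP
  · exact Or.inl (diam_le fun u _ v _ => (gridDist_le u v).trans (by omega))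
  -- There are `2 ^ n + 1` rows and as many columns, but at most `2 ^ n` cut edges. An uncut row and
  -- an uncut column form a cross on which `ind A` is constant.
  obtain ⟨j, hj⟩ : ∃ j, j ∉ (cut (ind A)).image fun e => e.1.2 := by
    by_contra! hc
    have := (Finset.card_le_card fun j _ => hc j : (Finset.univ : Finset (Fin (2 ^ n + 1))).card ≤ _)
      |>.trans Finset.card_image_le
    rw [Finset.card_univ, Fintype.card_fin] at this
    omega
  obtain ⟨i, hi⟩ : ∃ i, i ∉ (cut (ind A)).image fun e => e.1.1 := by
    by_contra! hc
    have := (Finset.card_le_card fun i _ => hc i : (Finset.univ : Finset (Fin (2 ^ n + 1))).card ≤ _)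
      |>.trans Finset.card_image_le
    rw [Finset.card_univ, Fintype.card_fin] at this
    omega
  have hrow : ∀ e ∈ cut (ind A), e.1.2 ≠ j := fun e he h =>
    hj (Finset.mem_image.2 ⟨e, he, h⟩)
  have hcol : ∀ e ∈ cut (ind A), e.1.1 ≠ i := fun e he h =>
    hi (Finset.mem_image.2 ⟨e, he, h⟩)
  -- A vertex on the other side of `A` from the cross has both its row and its column cut, so its
  -- coordinates are coordinates of boundary edges.
  have main (B : Finset (Vertex n)) (hB : ∀ u ∈ B, ¬(u ∈ A ↔ (i, j) ∈ A)) :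
      diam B ≤ 4 * (cut (ind A)).card := by
    have hr (u) (hu : u ∈ B) : ∃ e ∈ cut (ind A), e.1.2 = u.2 := by
      by_contra! hc
      exact hB u hu (ind_eq_ind_iff.1
        ((eq_of_forall_cut_snd_ne hc u.1 i).trans (eq_of_forall_cut_fst_ne hcol u.2 j)))
    have hc (u) (hu : u ∈ B) : ∃ e ∈ cut (ind A), e.1.1 = u.1 := by
      by_contra! hc
      exact hB u hu (ind_eq_ind_iff.1
        ((eq_of_forall_cut_fst_ne hc u.2 j).trans (eq_of_forall_cut_snd_ne hrow u.1 i)))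
    refine diam_le fun u hu v hv => ?_
    obtain ⟨e₁, he₁, h₁⟩ := hr u hu
    obtain ⟨e₂, he₂, h₂⟩ := hr v hv
    obtain ⟨e₃, he₃, h₃⟩ := hc u hu
    obtain ⟨e₄, he₄, h₄⟩ := hc v hv
    have h₅ := hF.gridDist_add_two_le he₁ he₂
    have h₆ := hF.gridDist_add_two_le he₃ he₄
    unfold gridDist at h₅ h₆ ⊢
    rw [h₁, h₂] at h₅
    rw [h₃, h₄] at h₆
    omega
  by_cases h : (i, j) ∈ A
  · exact Or.inr (main _ fun u hu => by simpa [h] using hu)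
  · exact Or.inl (main _ fun u hu => by simpa [h] using hu)

/-! ### Measures whose support meets the boundary -/

/-- The support of the measure contains an endpoint of an edge of `F`. -/
def Meets (F : Finset (Vertex n × Vertex n)) (μ : SignedMeasure (Vertex n)) : Prop :=
  ∃ e ∈ F, e.1 ∈ supp μ ∨ e.2 ∈ supp μ

theorem Meets.exists_mem_supp {A : Finset (Vertex n)} {μ : SignedMeasure (Vertex n)}
    (h : Meets (cut (ind A)) μ) : ∃ e ∈ cut (ind A), ∃ x ∈ supp μ, gridDist e.1 x ≤ 1 ∧
      (x = e.1 ∨ x = e.2) := by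
  obtain ⟨e, he, h | h⟩ := h
  · exact ⟨e, he, _, h, by simp [gridDist_self], Or.inl rfl⟩
  · exact ⟨e, he, _, h, (gridDist_of_mem_edges (mem_cut.1 he).1).le, Or.inr rfl⟩

/-- If no cut edge touches the support, a connected set containing it lies on one side of `A`, so `μ
A` is `0` or the total mass, also `0`. -/
theorem meets_of_apply_ne_zero {μ : SignedMeasure (Vertex n)} {A : Finset (Vertex n)}
    (hzero : μ Set.univ = 0) {u : Vertex n}
    (hconn : ((graph n).induce (supp μ ∪ {u})).Connected) (hA : μ (A : Set (Vertex n)) ≠ 0) :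
    Meets (cut (ind A)) μ := by
  classical
  by_contra hm
  have hedge (x y : Vertex n) (hxy : x ∈ supp μ ∨ y ∈ supp μ) (he : (x, y) ∈ edges n) :
      (x ∈ A ↔ y ∈ A) := by
    by_contra hne
    exact hm ⟨(x, y), mem_cut_ind.2 ⟨he, hne⟩, hxy⟩
  have hadj (x y : (supp μ ∪ {u} : Set (Vertex n)))
      (h : ((graph n).induce (supp μ ∪ {u})).Adj x y) : (x.1 ∈ A ↔ y.1 ∈ A) := by
    have h' : (graph n).Adj x.1 y.1 := h
    -- Only `u` can lie outside the support, and an edge has distinct endpoints.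
    have hs : x.1 ∈ supp μ ∨ y.1 ∈ supp μ := by
      rcases x.2 with hx | hx
      · exact Or.inl hx
      rcases y.2 with hy | hy
      · exact Or.inr hy
      · rw [Set.mem_singleton_iff] at hx hy
        exact absurd (hx.trans hy.symm) h'.ne
    rcases h' with h' | h'
    · exact hedge _ _ hs h'
    · exact (hedge _ _ hs.symm h').symm
  have hiff (x y : (supp μ ∪ {u} : Set (Vertex n))) : (x.1 ∈ A ↔ y.1 ∈ A) := by
    obtain ⟨p⟩ := hconn.preconnected x y
    induction p with
    | nil => rfl
    | cons h _ ih => exact (hadj _ _ h).trans ih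
  have hnot {v} (hv : v ∉ supp μ) : μ {v} = 0 := by simpa [supp] using hv
  by_cases hu : u ∈ A
  · apply hA
    rw [← hzero, ← Finset.coe_univ, signedMeasure_apply_finset, signedMeasure_apply_finset]
    refine Finset.sum_subset (Finset.subset_univ A) fun v _ hv => hnot fun hs => hv ?_
    exact (hiff ⟨v, Or.inl hs⟩ ⟨u, Or.inr rfl⟩).2 hu
  · apply hA
    rw [signedMeasure_apply_finset]
    refine Finset.sum_eq_zero fun v hv => hnot fun hs => hu ?_
    exact (hiff ⟨v, Or.inl hs⟩ ⟨u, Or.inr rfl⟩).1 hv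

theorem abs_apply_le_of_chained {μ : Tree n → SignedMeasure (Vertex n)} {C₄ : ℝ}
    (hC₄ : 0 ≤ C₄) (hzero : ZeroMass μ) (hsize : SizeBound μ C₄) {A : Finset (Vertex n)}
    (hF : Chained (cut (ind A))) (t : Tree n) :
    |μ t (A : Set (Vertex n))| ≤
      C₄ * ((4 : ℝ) ^ (-(n : ℤ)) * (4 * ((cut (ind A)).card : ℝ) + 1)) := by
  classical
  have key (B : Finset (Vertex n)) (hB : diam B ≤ 4 * (cut (ind A)).card) :
      |μ t (B : Set (Vertex n))| ≤
        C₄ * ((4 : ℝ) ^ (-(n : ℤ)) * (4 * ((cut (ind A)).card : ℝ) + 1)) := by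
    refine (hsize t B).trans (mul_le_mul_of_nonneg_left ((min_le_right _ _).trans ?_) hC₄)
    refine mul_le_mul_of_nonneg_left ?_ (by positivity)
    gcongr
    exact_mod_cast hB
  rcases diam_le_or_diam_compl_le hF with h | h
  · exact key A h
  · have h0 : μ t (A : Set (Vertex n)) = -μ t ((Aᶜ : Finset (Vertex n)) : Set (Vertex n)) := by
      have h1 := hzero t
      rw [← Finset.coe_univ, signedMeasure_apply_finset, ← Finset.sum_add_sum_compl A,
        ← signedMeasure_apply_finset, ← signedMeasure_apply_finset] at h1
      linarith
    rw [h0, abs_neg]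
    exact key _ h

theorem separation_le_gridDist {μ : Tree n → SignedMeasure (Vertex n)} {C₂ : ℝ}
    (hsep : Separated μ C₂) {t t' : Tree n} (hne : t ≠ t') {x y : Vertex n}
    (hx : x ∈ supp (μ t)) (hy : y ∈ supp (μ t')) :
    C₂⁻¹ * 2 ^ n / 2 ^ max (gen t) (gen t') ≤ (gridDist x y : ℝ) := by
  refine le_trans (le_of_eq ?_) ((hsep t t' hne x hx y hy).trans
    (by exact_mod_cast dist_le_gridDist x y))
  rw [zpow_sub₀ two_ne_zero, zpow_natCast, zpow_natCast, mul_div_assoc]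

theorem separation_le_card {μ : Tree n → SignedMeasure (Vertex n)} {C₂ : ℝ}
    (hsep : Separated μ C₂) {A : Finset (Vertex n)} (hF : Chained (cut (ind A))) {t t' : Tree n}
    (hne : t ≠ t') (ht : Meets (cut (ind A)) (μ t)) (ht' : Meets (cut (ind A)) (μ t')) :
    C₂⁻¹ * 2 ^ n / 2 ^ max (gen t) (gen t') ≤ 2 * ((cut (ind A)).card : ℝ) := by
  obtain ⟨e, he, x, hx, hex, -⟩ := ht.exists_mem_supp
  obtain ⟨e', he', y, hy, hey, -⟩ := ht'.exists_mem_supp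
  refine (separation_le_gridDist hsep hne hx hy).trans ?_
  have h1 := hF.gridDist_add_two_le he he'
  have h2 := gridDist_triangle x e.1 y
  have h3 := gridDist_triangle e.1 e'.1 y
  rw [gridDist_comm x e.1] at h2
  exact_mod_cast (by omega : gridDist x y ≤ 2 * (cut (ind A)).card)

open Classical in
/-- The measures of one generation which meet a chained boundary are controlled in number by the
length of the boundary, unless there is only one. -/
theorem card_filter_meets_mul_le {μ : Tree n → SignedMeasure (Vertex n)} {C₂ : ℝ} (hC₂ : 0 < C₂)
    (hsep : Separated μ C₂) {A : Finset (Vertex n)} (hF : Chained (cut (ind A))) (k : Fin (n - 1))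
    (hcard : 2 ≤ (Finset.univ.filter fun t : Generation k =>
      Meets (cut (ind A)) (μ ⟨k, t⟩)).card) :
    ((Finset.univ.filter fun t : Generation k => Meets (cut (ind A)) (μ ⟨k, t⟩)).card : ℝ) *
      (C₂⁻¹ * 2 ^ n / 2 ^ (k : ℕ)) ≤ 6 * ((cut (ind A)).card : ℝ) := by
  set F := cut (ind A) with hFdef
  set T := Finset.univ.filter fun t : Generation k => Meets F (μ ⟨k, t⟩) with hT
  set r : ℝ := C₂⁻¹ * 2 ^ n / 2 ^ (k : ℕ) with hr
  have hr0 : 0 < r := by positivity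
  have hex : ∀ t : Generation k, ∃ e : Vertex n × Vertex n, ∃ x : Vertex n, t ∈ T →
      e ∈ F ∧ x ∈ supp (μ ⟨k, t⟩) ∧ gridDist e.1 x ≤ 1 ∧ (x = e.1 ∨ x = e.2) := by
    intro t
    by_cases ht : t ∈ T
    · rw [hT, Finset.mem_filter] at ht
      obtain ⟨e, he, x, hx, h⟩ := ht.2.exists_mem_supp
      exact ⟨e, x, fun _ => ⟨he, hx, h⟩⟩
    · exact ⟨(pt n 0 0, pt n 0 0), pt n 0 0, fun h => absurd h ht⟩
  choose e x hex using hex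
  have hdist {t t' : Generation k} (ht : t ∈ T) (ht' : t' ∈ T) (hne : t ≠ t') :
      r ≤ (gridDist (x t) (x t') : ℝ) := by
    have := separation_le_gridDist hsep (t := ⟨k, t⟩) (t' := ⟨k, t'⟩) (by simpa using hne)
      (hex t ht).2.1 (hex t' ht').2.1
    simpa [gen] using this
  -- At small scale it suffices that the touching points are distinct endpoints of `F`. At large
  -- scale disjoint balls are packed.
  rcases le_or_gt r 2 with hr2 | hr2
  · have h1 : T.card ≤ 2 * F.card := by
      have hinj : Set.InjOn x T := by
        intro t ht t' ht' hxx
        by_contra hne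
        have := hdist ht ht' hne
        rw [hxx, gridDist_self, Nat.cast_zero] at this
        linarith
      have hmaps : T.image x ⊆ F.image Prod.fst ∪ F.image Prod.snd := by
        intro y hy
        obtain ⟨t, ht, rfl⟩ := Finset.mem_image.1 hy
        obtain ⟨he, -, -, h | h⟩ := hex t ht
        · exact Finset.mem_union_left _ (Finset.mem_image.2 ⟨_, he, h.symm⟩)
        · exact Finset.mem_union_right _ (Finset.mem_image.2 ⟨_, he, h.symm⟩)
      rw [← Finset.card_image_of_injOn hinj]
      refine (Finset.card_le_card hmaps).trans ((Finset.card_union_le _ _).trans ?_)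
      have i1 := Finset.card_image_le (s := F) (f := Prod.fst)
      have i2 := Finset.card_image_le (s := F) (f := Prod.snd)
      omega
    have h2 : (T.card : ℝ) ≤ 2 * F.card := by exact_mod_cast h1
    have h3 : (0 : ℝ) ≤ F.card := by positivity
    nlinarith
  -- The largest `q` with `4q + 2 < r`: replacing touching points by initial vertices costs 2, so
  -- balls of radius `2q` remain disjoint, while `r ≤ 6(q + 1)`.
  · obtain ⟨q, hq⟩ : ∃ q : ℕ, ⌈(r - 2) / 4⌉₊ = q + 1 :=
      Nat.exists_eq_succ_of_ne_zero (Nat.ceil_pos.2 (by linarith)).ne'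
    have hq1 : r ≤ 4 * (q : ℝ) + 6 := by
      have := Nat.le_ceil ((r - 2) / 4)
      rw [hq] at this
      push_cast at this
      linarith
    have hq2 : 4 * (q : ℝ) + 2 < r := by
      have : q < ⌈(r - 2) / 4⌉₊ := by omega
      rw [Nat.lt_ceil] at this
      linarith
    have hfar {t t' : Generation k} (ht : t ∈ T) (ht' : t' ∈ T) (hne : t ≠ t') :
        4 * q < gridDist (e t).1 (e t').1 := by
      have h1 : 4 * q + 2 < gridDist (x t) (x t') := by
        exact_mod_cast hq2.trans_le (hdist ht ht' hne)
      have h2 := gridDist_triangle (x t) (e t).1 (x t')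
      have h3 := gridDist_triangle (e t).1 (e t').1 (x t')
      have h4 := (hex t ht).2.2.1
      have h5 := (hex t' ht').2.2.1
      rw [gridDist_comm (x t) (e t).1] at h2
      omega
    have hball (t) (ht : t ∈ T) :
        q + 1 ≤ (F.filter fun z => gridDist (e t).1 z.1 ≤ 2 * q).card := by
      rcases hF.subset_ball_or_lt_card (hex t ht).1 q with h | h
      -- A second touching measure prevents the ball from swallowing `F`.
      · obtain ⟨t', ht', hne⟩ := Finset.exists_mem_ne (s := T) (by omega) t
        have h1 := h _ (hex t' ht').1
        have h2 := hfar ht ht' hne.symm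
        omega
      · exact h
    have hdisj : (T : Set (Generation k)).PairwiseDisjoint
        fun t => F.filter fun z => gridDist (e t).1 z.1 ≤ 2 * q := by
      intro t ht t' ht' hne
      refine Finset.disjoint_left.2 fun z hz hz' => ?_
      rw [Finset.mem_filter] at hz hz'
      have h1 := hfar ht ht' hne
      have h2 := gridDist_triangle (e t).1 z.1 (e t').1
      rw [gridDist_comm z.1 (e t').1] at h2
      omega
    have hcount : T.card * (q + 1) ≤ F.card := by
      rw [← smul_eq_mul]
      refine (Finset.card_nsmul_le_sum T _ _ hball).trans ?_
      rw [← Finset.card_biUnion hdisj]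
      exact Finset.card_le_card (Finset.biUnion_subset.2 fun t _ => Finset.filter_subset _ _)
    have h1 : (T.card : ℝ) * (q + 1) ≤ F.card := by exact_mod_cast hcount
    have h2 : (0 : ℝ) ≤ T.card := by positivity
    have h3 : (0 : ℝ) ≤ q := by positivity
    nlinarith

/-! ### Summation over the generations -/

/-- Since `1/√2 ≤ 3/4`, the geometric series is at most 4 times its first term. The bound by `√r` is
carried along to close the induction once the leading term is counted. -/
theorem sum_sqrt_halving_le {X : ℝ} (m : ℕ) {r : ℝ} (hr : 0 ≤ r) :
    ∑ k ∈ Finset.range m, (if r / 2 ^ k ≤ X then √(r / 2 ^ k) else 0) ≤ 4 * √X ∧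
      ∑ k ∈ Finset.range m, (if r / 2 ^ k ≤ X then √(r / 2 ^ k) else 0) ≤ 4 * √r := by
  induction m generalizing r with
  | zero => simp
  | succ m ih =>
    obtain ⟨ih1, ih2⟩ := ih (r := r / 2) (by positivity)
    rw [Finset.sum_range_succ']
    have hdiv (k : ℕ) : r / 2 ^ (k + 1) = r / 2 / 2 ^ k := by
      rw [pow_succ', div_div]
    have hhalf : √(r / 2) ≤ 3 / 4 * √r := by
      rw [Real.sqrt_le_left (by positivity), mul_pow, Real.sq_sqrt hr]
      linarith
    simp only [hdiv, pow_zero, div_one]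
    have hs := Real.sqrt_nonneg r
    split_ifs with h
    · have := Real.sqrt_le_sqrt h
      constructor <;> linarith
    · constructor <;> linarith

theorem sqrt_sum_abs_sq_le {ι : Type*} [Fintype ι] {a : ι → ℝ} {s : Finset ι} {M : ℝ}
    (hM : 0 ≤ M) (ha : ∀ i, |a i| ≤ M) (hs : ∀ i, a i ≠ 0 → i ∈ s) :
    √(∑ i, |a i| ^ 2) ≤ √(s.card : ℝ) * M := by
  rw [← Real.sqrt_sq hM, ← Real.sqrt_mul (by positivity)]
  refine Real.sqrt_le_sqrt ?_
  have h : ∑ i, |a i| ^ 2 = ∑ i ∈ s, |a i| ^ 2 := by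
    refine (Finset.sum_subset (Finset.subset_univ s) fun i _ hi => ?_).symm
    have : a i = 0 := by
      by_contra h
      exact hi (hs i h)
    simp [this]
  rw [h, ← nsmul_eq_mul]
  exact Finset.sum_le_card_nsmul _ _ _ fun i _ => pow_le_pow_left₀ (abs_nonneg _) (ha i) 2

theorem mixedNorm_ind (μ : Tree n → SignedMeasure (Vertex n)) (A : Finset (Vertex n)) :
    mixedNorm μ (ind A) = ∑ k : Fin (n - 1),
      √(∑ t : Generation k, |μ ⟨k, t⟩ (A : Set (Vertex n))| ^ 2) := by
  simp [mixedNorm, ind, signedMeasure_apply_finset, Finset.sum_ite_mem]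

theorem mixedNorm_ind_le {μ : Tree n → SignedMeasure (Vertex n)} {C₂ C₄ : ℝ} (hC₂ : 0 < C₂)
    (hC₄ : 0 ≤ C₄) (hzero : ZeroMass μ) (hsep : Separated μ C₂) (hsize : SizeBound μ C₄)
    (hconn : AlmostConnected μ) {A : Finset (Vertex n)} (hF : Chained (cut (ind A))) :
    mixedNorm μ (ind A) ≤ C₄ * (5 + 7 * C₂) * ((4 : ℝ) ^ n)⁻¹ * (cut (ind A)).card := by
  classical
  set F := cut (ind A) with hFdef
  set P : ℝ := (F.card : ℝ) with hP
  have hP0 : 0 ≤ P := by positivity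
  set ε : ℝ := ((4 : ℝ) ^ n)⁻¹ with hε
  have hε0 : 0 < ε := by positivity
  have hmeets (t : Tree n) (h : μ t (A : Set (Vertex n)) ≠ 0) : Meets F (μ t) := by
    obtain ⟨u, hu⟩ := hconn t
    exact meets_of_apply_ne_zero (hzero t) hu h
  rw [mixedNorm_ind]
  by_cases hact : ∃ t, Meets F (μ t)
  swap
  · have h0 (t : Tree n) : μ t (A : Set (Vertex n)) = 0 := by
      by_contra h
      exact hact ⟨t, hmeets t h⟩
    simp only [h0, abs_zero, ne_eq, OfNat.ofNat_ne_zero, not_false_eq_true, zero_pow,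
      Finset.sum_const_zero, Real.sqrt_zero]
    positivity
  have hP1 : 1 ≤ P := by
    obtain ⟨t, e, he, -⟩ := hact
    exact Nat.one_le_cast.2 (Finset.card_pos.2 ⟨e, he⟩)
  -- With `t₀` of least generation, its separation from any other touching measure is at the scale
  -- of the latter.
  obtain ⟨t₀, ht₀, hmin⟩ : ∃ t₀, Meets F (μ t₀) ∧ ∀ t, Meets F (μ t) → gen t₀ ≤ gen t := by
    obtain ⟨t₀, h₀, h₁⟩ := (Finset.univ.filter fun t => Meets F (μ t)).exists_min_image gen
      (by obtain ⟨t, ht⟩ := hact; exact ⟨t, by simpa using ht⟩)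
    exact ⟨t₀, by simpa using h₀, fun t ht => h₁ t (by simpa using ht)⟩
  set r : ℕ → ℝ := fun k => C₂⁻¹ * 2 ^ n / 2 ^ k with hr
  have hr0 (k) : 0 < r k := by simp only [hr]; positivity
  set M : ℝ := C₄ * (ε * (4 * P + 1)) with hM
  have hM0 : 0 ≤ M := by positivity
  have hbound1 (t : Tree n) : |μ t (A : Set (Vertex n))| ≤ M := by
    have := abs_apply_le_of_chained hC₄ hzero hsize hF t
    rwa [zpow_neg, zpow_natCast] at this
  -- The mass bound `2^(-n-1-k)` expressed through `r k`.
  have hbound2 (t : Tree n) : |μ t (A : Set (Vertex n))| ≤ C₄ * (C₂ * ε / 2) * r (gen t) := by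
    refine (hsize t A).trans ((mul_le_mul_of_nonneg_left (min_le_left _ _) hC₄).trans
      (le_of_eq ?_))
    have h4 : (4 : ℝ) ^ n = 2 ^ n * 2 ^ n := by rw [← mul_pow]; norm_num
    rw [zpow_sub₀ two_ne_zero, zpow_sub₀ two_ne_zero, zpow_neg, zpow_natCast, zpow_natCast,
      zpow_one]
    simp only [hε, hr, h4]
    field_simp
  set c : ℝ := C₄ * (C₂ * ε / 2) * √(6 * P) with hc
  have hc0 : 0 ≤ c := by positivity
  have hterm (k : Fin (n - 1)) : √(∑ t : Generation k, |μ ⟨k, t⟩ (A : Set (Vertex n))| ^ 2) ≤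
      (if k = t₀.1 then M else 0) + c * (if r k ≤ 2 * P then √(r k) else 0) := by
    set T := Finset.univ.filter fun t : Generation k => Meets F (μ ⟨k, t⟩) with hT
    have hTmem (t : Generation k) (h : μ ⟨k, t⟩ (A : Set (Vertex n)) ≠ 0) : t ∈ T := by
      simpa [hT] using hmeets _ h
    have h1 := sqrt_sum_abs_sq_le hM0 (fun t : Generation k => hbound1 ⟨k, t⟩) hTmem
    have h2 := sqrt_sum_abs_sq_le (M := C₄ * (C₂ * ε / 2) * r k)
      (mul_nonneg (by positivity) (hr0 k).le) (fun t : Generation k => hbound2 ⟨k, t⟩) hTmem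
    have hnn1 : 0 ≤ if k = t₀.1 then M else 0 := by split_ifs <;> simp [hM0]
    have hnn2 : 0 ≤ c * (if r k ≤ 2 * P then √(r k) else 0) := by
      refine mul_nonneg hc0 ?_
      split_ifs <;> positivity
    have many (hcount : (T.card : ℝ) * r k ≤ 6 * P) (hrP : r k ≤ 2 * P) :
        √(∑ t : Generation k, |μ ⟨k, t⟩ (A : Set (Vertex n))| ^ 2) ≤
          (if k = t₀.1 then M else 0) + c * (if r k ≤ 2 * P then √(r k) else 0) := by
      rw [if_pos hrP]
      rw [if_pos hrP] at hnn2
      -- With `N = T.card`, `√N * r k = √(N * r k) * √(r k)`.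
      refine h2.trans (le_trans (le_of_eq ?_) (le_trans (mul_le_mul_of_nonneg_left
        (Real.sqrt_le_sqrt hcount) (by positivity : 0 ≤ C₄ * (C₂ * ε / 2) * √(r k))) ?_))
      · rw [Real.sqrt_mul (by positivity)]
        nth_rw 1 [← Real.mul_self_sqrt (hr0 k).le]
        ring
      · have : C₄ * (C₂ * ε / 2) * √(r k) * √(6 * P) = c * √(r k) := by rw [hc]; ring
        rw [this]
        linarith
    rcases lt_or_ge T.card 2 with hlt | hge
    · rcases Nat.eq_zero_or_pos T.card with hz | hpos
      · rw [hz, Nat.cast_zero, Real.sqrt_zero, zero_mul] at h1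
        linarith
      · have hone : T.card = 1 := by omega
        by_cases hk : k = t₀.1
        · rw [if_pos hk]
          rw [hone, Nat.cast_one, Real.sqrt_one, one_mul] at h1
          linarith
        · obtain ⟨t, ht⟩ := Finset.card_pos.1 hpos
          have ht' : Meets F (μ ⟨k, t⟩) := by simpa [hT] using ht
          have hne : t₀ ≠ ⟨k, t⟩ := fun h => hk (by rw [h])
          have h3 := separation_le_card hsep hF hne ht₀ ht'
          rw [max_eq_right (hmin _ ht')] at h3
          have h4 : r k ≤ 2 * P := h3
          refine many ?_ h4
          rw [hone]
          push_cast
          linarith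
    · obtain ⟨t, ht, t', ht', hne⟩ := Finset.one_lt_card.1 hge
      have h3 := separation_le_card hsep hF (t := ⟨k, t⟩) (t' := ⟨k, t'⟩) (by simpa using hne)
        (by simpa [hT] using ht) (by simpa [hT] using ht')
      exact many (card_filter_meets_mul_le hC₂ hsep hF k hge) (by simpa [gen] using h3)
  have hgeom := (sum_sqrt_halving_le (X := 2 * P) (n - 1) (r := C₂⁻¹ * 2 ^ n)
    (by positivity)).1
  -- `√12 ≤ 7/2`, the source of the 7 in `5 + 7 * C₂`; the 5 is `4P + 1 ≤ 5P`.
  have h12 : √(6 * P) * √(2 * P) ≤ 7 / 2 * P := by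
    rw [← Real.sqrt_mul (by positivity), Real.sqrt_le_left (by positivity)]
    nlinarith [sq_nonneg P]
  calc ∑ k : Fin (n - 1), √(∑ t : Generation k, |μ ⟨k, t⟩ (A : Set (Vertex n))| ^ 2)
      ≤ ∑ k : Fin (n - 1),
        ((if k = t₀.1 then M else 0) + c * (if r k ≤ 2 * P then √(r k) else 0)) :=
        Finset.sum_le_sum fun k _ => hterm k
    _ = M + c * ∑ k ∈ Finset.range (n - 1), (if r k ≤ 2 * P then √(r k) else 0) := by
        rw [Finset.sum_add_distrib, Finset.sum_ite_eq', if_pos (Finset.mem_univ _),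
          ← Finset.mul_sum,
          Fin.sum_univ_eq_sum_range fun k => if r k ≤ 2 * P then √(r k) else 0]
    _ ≤ M + c * (4 * √(2 * P)) := by gcongr
    _ = C₄ * ε * (4 * P + 1) + C₄ * C₂ * ε * 2 * (√(6 * P) * √(2 * P)) := by
        rw [hM, hc]; ring
    _ ≤ C₄ * ε * (5 * P) + C₄ * C₂ * ε * 2 * (7 / 2 * P) := by
        gcongr
        linarith
    _ = C₄ * (5 + 7 * C₂) * ε * P := by ring

theorem card_edges_le (n : ℕ) : (edges n).card ≤ 2 * (2 ^ n + 1) ^ 2 := by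
  classical
  have h : (edges n).card ≤ (Finset.univ : Finset (Vertex n × Bool)).card := by
    -- An edge is determined by its initial vertex and its direction.
    refine Finset.card_le_card_of_injOn (fun e => (e.1, decide (e.2.1 = e.1.1)))
      (fun _ _ => by simp) ?_
    rintro ⟨u, v⟩ he ⟨u', v'⟩ he' h
    rw [Finset.mem_coe, mem_edges] at he he'
    simp only [Prod.mk.injEq, decide_eq_decide] at h he he'
    obtain ⟨rfl, h⟩ := h
    simp only [Fin.ext_iff] at h
    refine Prod.ext rfl (Prod.ext (Fin.ext ?_) (Fin.ext ?_)) <;> dsimp only <;> omega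
  refine h.trans (le_of_eq ?_)
  simp [Finset.card_univ, Fintype.card_prod]
  ring

theorem card_edges_pos (n : ℕ) : 0 < (edges n).card :=
  Finset.card_pos.2 ⟨_, horizontal_mem_edges (i := 0) (j := 0) (by positivity) (by positivity)⟩

end DyadicGrid

theorem mainTheorem5 (n : ℕ) (hn : 2 ≤ n) (C₂ C₄ : ℝ) (hC₂ : 1 / 2 ≤ C₂) (hC₄ : 1 / 2 ≤ C₄)
    (μ : DyadicGrid.Tree n → MeasureTheory.SignedMeasure (DyadicGrid.Vertex n))
    (hzero : DyadicGrid.ZeroMass μ)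
    (hsep : DyadicGrid.Separated μ C₂)
    (hsize : DyadicGrid.SizeBound μ C₄)
    (hconn : DyadicGrid.AlmostConnected μ)
    (f : DyadicGrid.Vertex n → ℝ) :
    ∑ k : Fin (n - 1),
        Real.sqrt (∑ t : DyadicGrid.Generation k, |∫ᵛ v, f v ∂•(μ ⟨k, t⟩)| ^ 2) ≤
      (C₄ * (20 + 40 * C₂)) *
        ∑ e ∈ DyadicGrid.edges n, |f e.1 - f e.2| * DyadicGrid.thickness n e := by
  have hC₂' : 0 < C₂ := by linarith
  have hC₄' : 0 ≤ C₄ := by linarith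
  have main := DyadicGrid.le_totalVar_of_forall_chained (L := DyadicGrid.mixedNorm μ)
    (C := C₄ * (5 + 7 * C₂) * ((4 : ℝ) ^ n)⁻¹)
    (DyadicGrid.mixedNorm_add_le μ) (fun c hc f => DyadicGrid.mixedNorm_smul_le μ hc f)
    (fun c => (DyadicGrid.mixedNorm_const hzero c).le) (by positivity)
    (fun A hA => by
      rw [DyadicGrid.totalVar_ind]
      exact DyadicGrid.mixedNorm_ind_le hC₂' hC₄' hzero hsep hsize hconn hA) f
  simp only [DyadicGrid.integral_signedMeasure_eq_sum, DyadicGrid.thickness]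
  rw [← Finset.sum_mul]
  refine main.trans ?_
  rw [mul_comm (∑ e ∈ DyadicGrid.edges n, _), ← mul_assoc]
  refine mul_le_mul_of_nonneg_right ?_ (DyadicGrid.totalVar_nonneg f)
  have hE : (0 : ℝ) < (DyadicGrid.edges n).card := by exact_mod_cast DyadicGrid.card_edges_pos n
  have hE' : ((DyadicGrid.edges n).card : ℝ) ≤ 2 * (2 ^ n + 1) ^ 2 := by
    exact_mod_cast DyadicGrid.card_edges_le n
  have h2n : (4 : ℝ) ≤ 2 ^ n := by
    calc (4 : ℝ) = 2 ^ 2 := by norm_num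
      _ ≤ 2 ^ n := pow_le_pow_right₀ (by norm_num) hn
  have h4 : (4 : ℝ) ^ n = 2 ^ n * 2 ^ n := by rw [← mul_pow]; norm_num
  -- For `n ≥ 2`, `2^n + 1 ≤ (5/4) 2^n`. The factor `25/8` still fits: `5 * 25/8 ≤ 20` and `7 * 25/8
  -- ≤ 40`.
  have hE'' : ((DyadicGrid.edges n).card : ℝ) ≤ 25 / 8 * 4 ^ n := by
    rw [h4]; nlinarith
  rw [mul_one_div, ← div_eq_mul_inv, div_le_div_iff₀ (by positivity) hE]
  calc C₄ * (5 + 7 * C₂) * ((DyadicGrid.edges n).card : ℝ)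
      ≤ C₄ * (5 + 7 * C₂) * (25 / 8 * 4 ^ n) := by gcongr
    _ = C₄ * ((5 + 7 * C₂) * (25 / 8)) * 4 ^ n := by ring
    _ ≤ C₄ * (20 + 40 * C₂) * 4 ^ n := by
        gcongr
        linarith
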